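/- Let \(d\ge 2\), and let \(\mathcal{K}_d\) be the set of \(d\)-dimensional convex bodies, i.e. convex compact subsets of \(\mathbb{R}^d\) with non-empty interior, equipped with the Hausdorff distance. An affine point is a map \(p:\mathcal{K}_d\to\mathbb{R}^d\) that is continuous with respect to the Hausdorff distance and the Euclidean norm and satisfies \(p(T(C))=T(p(C))\) for every \(C\in\mathcal{K}_d\) and every invertible affine map \(T:\mathbb{R}^d\to\mathbb{R}^d\). For \(C\in\mathcal{K}_d\) put \[ \mathfrak{F}_d(C)=\{x\in\mathbb{R}^d : T(x)=x \text{ for every invertible affine map } T:\mathbb{R}^d\to\mathbb{R}^d \text{ with } T(C)=C\}. \] Let \(K\in\mathcal{K}_d\) and \(x_0\in\mathfrak{F}_d(K)\cap\partial K\). Then there exists an affine point \(p\) with \(p(K)=x_0\) and \(p(C)\in C\) for every \(C\in\mathcal{K}_d\). -/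

import Mathlib

/-- The set `𝒦_d` of `d`-dimensional convex bodies: convex compact subsets of Euclidean space `ℝ^d`
with non-empty interior. Its topology is the one of the Hausdorff distance, inherited from the
metric on Mathlib's `ConvexBody`. -/
abbrev FullConvexBody (d : ℕ) : Type :=
  {C : ConvexBody (EuclideanSpace ℝ (Fin d)) //
    (interior (C : Set (EuclideanSpace ℝ (Fin d)))).Nonempty}

namespace FullConvexBody

variable {d : ℕ}

/-- The underlying set of points of a convex body. -/
def toSet (C : FullConvexBody d) : Set (EuclideanSpace ℝ (Fin d)) :=
  (C.1 : Set (EuclideanSpace ℝ (Fin d)))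

/-- The image `T(C)` of a convex body under an invertible affine map `T` of `ℝ^d`. -/
def image (T : EuclideanSpace ℝ (Fin d) ≃ᵃ[ℝ] EuclideanSpace ℝ (Fin d))
    (C : FullConvexBody d) : FullConvexBody d :=
  ⟨{ carrier := T '' C.toSet
     convex' := C.1.convex.affine_image T.toAffineMap
     isCompact' := C.1.isCompact.image (AffineMap.continuous_of_finiteDimensional T.toAffineMap)
     nonempty' := C.1.nonempty.image T },
   by
    have h := (AffineEquiv.toHomeomorphOfFiniteDimensional T).image_interior C.toSet
    have h2 : (interior (T '' C.toSet)).Nonempty := by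
      rw [AffineEquiv.coe_toHomeomorphOfFiniteDimensional] at h
      rw [← h]
      exact C.2.image T
    exact h2⟩

/-- The set `𝔉_d(C)` of points fixed by every affine symmetry of `C`. -/
def fixedPoints (C : FullConvexBody d) : Set (EuclideanSpace ℝ (Fin d)) :=
  {x | ∀ T : EuclideanSpace ℝ (Fin d) ≃ᵃ[ℝ] EuclideanSpace ℝ (Fin d),
    T '' C.toSet = C.toSet → T x = x}

end FullConvexBody

/-- An affine (invariant) point: a map `p : 𝒦_d → ℝ^d`, continuous for the Hausdorff distance and
the Euclidean norm, with `p (T(C)) = T (p C)` for all invertible affine maps `T`. -/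
structure IsAffinePoint {d : ℕ} (p : FullConvexBody d → EuclideanSpace ℝ (Fin d)) : Prop where
  continuous : Continuous p
  equivariant : ∀ (T : EuclideanSpace ℝ (Fin d) ≃ᵃ[ℝ] EuclideanSpace ℝ (Fin d))
    (C : FullConvexBody d), p (C.image T) = T (p C)

/-! Average the positions `T x₀` over the affine maps `T` with `T(K) ⊆ C`, against Haar measure on
the vector space of affine maps. Every such position lies in `C` because `x₀ ∈ K`, hence so does the
average. Post-composition with an affine equivalence multiplies both Haar measure and the weight by
constants, which cancel in the quotient `moment / mass`, so the average is equivariant.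

The weight is the positive part of `|det T| - cutoff`. Let `m` be the maximal determinant. Then `m *
vol K ≤ vol C`, with equality exactly when `C` is an affine image of `K` (`isAffineImage_iff`), and
the cutoff is `m` times the ratio of the two sides. Away from the affine images the cutoff is below
`m`, the mass is positive (`mass_pos`), and dominated convergence gives continuity. At an affine
image only maps onto `C` reach the cutoff. Two of them differ by a symmetry of `K`, which fixes
`x₀`, so they agree there (`app_eq_of_image_eq`). By compactness, for bodies near an affine image
every map that counts sends `x₀` close to this common value, so the average extends continuously. -/

open MeasureTheory Filter Topology Metric

namespace FullConvexBody

/-! ### Hausdorff perturbations of convex bodies, and volume -/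

section Geometry

variable {d : ℕ}

theorem isCompact_toSet (C : FullConvexBody d) : IsCompact C.toSet := C.1.isCompact

theorem isClosed_toSet (C : FullConvexBody d) : IsClosed C.toSet := C.1.isClosed

theorem convex_toSet (C : FullConvexBody d) : Convex ℝ C.toSet := C.1.convex

theorem toSet_image (T : EuclideanSpace ℝ (Fin d) ≃ᵃ[ℝ] EuclideanSpace ℝ (Fin d))
    (C : FullConvexBody d) : (C.image T).toSet = T '' C.toSet := rfl

theorem exists_mem_dist_lt {C C' : FullConvexBody d} {r : ℝ} (h : dist C C' < r)
    {x : EuclideanSpace ℝ (Fin d)} (hx : x ∈ C.toSet) : ∃ y ∈ C'.toSet, dist x y < r :=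
  exists_dist_lt_of_hausdorffDist_lt hx
    (by rwa [Subtype.dist_eq, ← ConvexBody.hausdorffDist_coe] at h)
    ConvexBody.hausdorffEDist_ne_top

/-- Every body contains a closed ball. -/
theorem exists_closedBall_subset (C : FullConvexBody d) :
    ∃ c, ∃ r > 0, closedBall c r ⊆ C.toSet := by
  obtain ⟨c, hc⟩ := C.2
  obtain ⟨r, hr, h⟩ := nhds_basis_closedBall.mem_iff.1 (mem_interior_iff_mem_nhds.1 hc)
  exact ⟨c, r, hr, h⟩

/-- If a ball of radius `r` lies in `C'`, then its centre lies in every body at Hausdorff distance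
less than `r` from `C'`. -/
theorem mem_of_closedBall_subset {C C' : FullConvexBody d} {y : EuclideanSpace ℝ (Fin d)} {r : ℝ}
    (hy : closedBall y r ⊆ C'.toSet) (h : dist C C' < r) : y ∈ C.toSet := by
  by_contra hyC
  have hr : 0 < r := dist_nonneg.trans_lt h
  obtain ⟨z, hz, hmin⟩ := exists_norm_eq_iInf_of_complete_convex C.1.nonempty
    C.isCompact_toSet.isComplete C.convex_toSet y
  have hin := (norm_eq_iInf_iff_real_inner_le_zero C.convex_toSet hz).1 hmin
  have hne : y - z ≠ 0 := fun h0 => hyC (by rw [sub_eq_zero.1 h0]; exact hz)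
  have hn : 0 < ‖y - z‖ := norm_pos_iff.2 hne
  -- Moving from `y` by `r` directly away from its nearest point `z` in `C` stays in the ball, but
  -- ends at distance more than `r` from `C`.
  have hu : y + (r / ‖y - z‖) • (y - z) ∈ C'.toSet := by
    apply hy
    rw [mem_closedBall, dist_eq_norm, add_sub_cancel_left, norm_smul, Real.norm_of_nonneg
      (by positivity), div_mul_cancel₀ _ hn.ne']
  obtain ⟨w, hw, hd⟩ := exists_mem_dist_lt (by rwa [dist_comm] at h) hu
  rw [dist_eq_norm] at hd
  have h1 := real_inner_le_norm (y - z) (y + (r / ‖y - z‖) • (y - z) - w)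
  have h2 : inner ℝ (y - z) (y + (r / ‖y - z‖) • (y - z) - w)
      = ‖y - z‖ * ‖y - z‖ + r * ‖y - z‖ - inner ℝ (y - z) (w - z) := by
    rw [show y + (r / ‖y - z‖) • (y - z) - w
      = (y - z) + (r / ‖y - z‖) • (y - z) - (w - z) by abel, inner_sub_right, inner_add_right,
      inner_smul_right, real_inner_self_eq_norm_mul_norm]
    field_simp
  have h3 := hin w hw
  nlinarith [mul_pos hn hn, mul_lt_mul_of_pos_left hd hn]

/-- By convexity, the ball of radius `(1 - t) * r` about each point of the shrunken body lies in
`C₀`, so `mem_of_closedBall_subset` applies. -/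
theorem eventually_homothety_image_subset (C₀ : FullConvexBody d) {c : EuclideanSpace ℝ (Fin d)}
    {r : ℝ} (hr : 0 < r) (hc : closedBall c r ⊆ C₀.toSet) {t : ℝ} (ht0 : 0 ≤ t) (ht : t < 1) :
    ∀ᶠ C in 𝓝 C₀, AffineMap.homothety c t '' C₀.toSet ⊆ C.toSet := by
  have h1t : 0 < 1 - t := sub_pos.2 ht
  filter_upwards [ball_mem_nhds C₀ (mul_pos h1t hr)] with C hC
  rintro _ ⟨x, hx, rfl⟩
  refine mem_of_closedBall_subset (fun u hu => ?_) (mem_ball.1 hC)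
  set y := AffineMap.homothety c t x with hydef
  have hyx : y = t • (x - c) + c := by
    rw [hydef, AffineMap.homothety_apply, vsub_eq_sub, vadd_eq_add]
  have hv : c + (1 - t)⁻¹ • (u - y) ∈ C₀.toSet := by
    apply hc
    rw [mem_closedBall, dist_eq_norm, add_sub_cancel_left, norm_smul, norm_inv,
      Real.norm_of_nonneg h1t.le, inv_mul_le_iff₀ h1t]
    rwa [mem_closedBall, dist_eq_norm] at hu
  have := C₀.convex_toSet hx hv ht0 h1t.le (by ring)
  rw [smul_add, smul_inv_smul₀ h1t.ne'] at this
  convert this using 1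
  rw [hyx]
  module

theorem eventually_subset_homothety_image (C₀ : FullConvexBody d) {c : EuclideanSpace ℝ (Fin d)}
    {r : ℝ} (hr : 0 < r) (hc : closedBall c r ⊆ C₀.toSet) {t : ℝ} (ht : 1 < t) :
    ∀ᶠ C in 𝓝 C₀, C.toSet ⊆ AffineMap.homothety c t '' C₀.toSet := by
  have h1t : 0 < t - 1 := sub_pos.2 ht
  have ht0 : 0 < t := one_pos.trans ht
  filter_upwards [ball_mem_nhds C₀ (mul_pos h1t hr)] with C hC x hx
  obtain ⟨y, hy, hxy⟩ := exists_mem_dist_lt (mem_ball.1 hC) hx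
  -- Chosen so that the preimage of `x` under the homothety is the convex combination of `y` and
  -- this point with weights `1 / t` and `(t - 1) / t`.
  have hv : c + (t - 1)⁻¹ • (x - y) ∈ C₀.toSet := by
    apply hc
    rw [mem_closedBall, dist_eq_norm, add_sub_cancel_left, norm_smul, norm_inv,
      Real.norm_of_nonneg h1t.le, inv_mul_le_iff₀ h1t]
    rw [dist_eq_norm] at hxy
    exact hxy.le
  have := C₀.convex_toSet hy hv (inv_pos.2 ht0).le (b := t⁻¹ * (t - 1)) (by positivity)
    (by field_simp; ring)
  refine ⟨_, this, ?_⟩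
  have h2 : t * (t⁻¹ * (t - 1)) = t - 1 := by field_simp
  rw [AffineMap.homothety_apply, vsub_eq_sub, vadd_eq_add, smul_sub, smul_add, smul_smul, smul_smul,
    mul_inv_cancel₀ ht0.ne', h2, smul_add, smul_smul, mul_inv_cancel₀ h1t.ne']
  module

/-- The homothety with nonzero ratio as an affine equivalence. -/
noncomputable def homothetyEquiv (c : EuclideanSpace ℝ (Fin d)) {t : ℝ} (ht : t ≠ 0) :
    EuclideanSpace ℝ (Fin d) ≃ᵃ[ℝ] EuclideanSpace ℝ (Fin d) :=
  AffineEquiv.homothetyUnitsMulHom c (Units.mk0 t ht)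

theorem coe_homothetyEquiv (c : EuclideanSpace ℝ (Fin d)) {t : ℝ} (ht : t ≠ 0) :
    (homothetyEquiv c ht : EuclideanSpace ℝ (Fin d) → EuclideanSpace ℝ (Fin d))
      = AffineMap.homothety c t :=
  AffineEquiv.coe_homothetyUnitsMulHom_apply c (Units.mk0 t ht)

theorem det_linear_homothetyEquiv (c : EuclideanSpace ℝ (Fin d)) {t : ℝ} (ht : t ≠ 0) :
    LinearMap.det ((homothetyEquiv c ht).linear :
      EuclideanSpace ℝ (Fin d) →ₗ[ℝ] EuclideanSpace ℝ (Fin d)) = t ^ d := by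
  have : ((homothetyEquiv c ht).linear :
      EuclideanSpace ℝ (Fin d) →ₗ[ℝ] EuclideanSpace ℝ (Fin d)) = t • LinearMap.id := by
    rw [← AffineMap.homothety_linear c t]
    rfl
  rw [this, LinearMap.det_smul]
  simp

/-- A monotone function of bodies that scales like the volume is continuous. -/
theorem continuous_of_mono_of_image {f : FullConvexBody d → ℝ}
    (hmono : ∀ C C' : FullConvexBody d, C.toSet ⊆ C'.toSet → f C ≤ f C')
    (himage : ∀ (S : EuclideanSpace ℝ (Fin d) ≃ᵃ[ℝ] EuclideanSpace ℝ (Fin d))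
      (C : FullConvexBody d), f (C.image S) = |LinearMap.det (S.linear :
        EuclideanSpace ℝ (Fin d) →ₗ[ℝ] EuclideanSpace ℝ (Fin d))| * f C) :
    Continuous f := by
  rw [continuous_iff_continuousAt]
  intro C₀
  obtain ⟨c, r, hr, hc⟩ := C₀.exists_closedBall_subset
  have hlim : Tendsto (fun t : ℝ => |t ^ d| * f C₀) (𝓝 1) (𝓝 (f C₀)) := by
    have : Continuous (fun t : ℝ => |t ^ d| * f C₀) := by fun_prop
    simpa using this.tendsto 1
  have hscale : ∀ (t : ℝ) (ht : t ≠ 0), f (C₀.image (homothetyEquiv c ht)) = |t ^ d| * f C₀ :=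
    fun t ht => by rw [himage, det_linear_homothetyEquiv]
  -- Dilates of `C₀` with ratio just below and just above 1 squeeze all nearby bodies; monotonicity
  -- turns this into bounds on `f`.
  refine tendsto_order.2 ⟨fun a ha => ?_, fun a ha => ?_⟩
  · have h1 : ∀ᶠ t in 𝓝[<] (1 : ℝ), a < |t ^ d| * f C₀ :=
      nhdsWithin_le_nhds (hlim.eventually_const_lt ha)
    have h2 : ∀ᶠ t in 𝓝[<] (1 : ℝ), 0 < t := nhdsWithin_le_nhds (lt_mem_nhds one_pos)
    obtain ⟨t, h1, h2, h3⟩ := (h1.and (h2.and self_mem_nhdsWithin)).exists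
    filter_upwards [C₀.eventually_homothety_image_subset hr hc h2.le h3] with C hC
    refine h1.trans_le ?_
    rw [← hscale t h2.ne']
    exact hmono _ _ (by rwa [toSet_image, coe_homothetyEquiv])
  · have h1 : ∀ᶠ t in 𝓝[>] (1 : ℝ), |t ^ d| * f C₀ < a :=
      nhdsWithin_le_nhds (hlim.eventually_lt_const ha)
    obtain ⟨t, h1, h3⟩ := (h1.and self_mem_nhdsWithin).exists
    have h3' : (1 : ℝ) < t := h3
    filter_upwards [C₀.eventually_subset_homothety_image hr hc h3'] with C hC
    refine lt_of_le_of_lt ?_ h1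
    rw [← hscale t (one_pos.trans h3').ne']
    exact hmono _ _ (by rwa [toSet_image, coe_homothetyEquiv])

/-- The volume of a body. -/
noncomputable def vol (C : FullConvexBody d) : ℝ := volume.real C.toSet

theorem vol_pos (C : FullConvexBody d) : 0 < C.vol := by
  refine ENNReal.toReal_pos ?_ C.isCompact_toSet.measure_lt_top.ne
  exact (Measure.measure_pos_of_nonempty_interior volume C.2).ne'

theorem vol_mono {C C' : FullConvexBody d} (h : C.toSet ⊆ C'.toSet) : C.vol ≤ C'.vol :=
  measureReal_mono h C'.isCompact_toSet.measure_lt_top.ne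

theorem subset_closure_interior_of_convex {V : Type*} [NormedAddCommGroup V] [NormedSpace ℝ V]
    {s : Set V} (hs : Convex ℝ s) (hne : (interior s).Nonempty) : s ⊆ closure (interior s) := by
  rw [hs.closure_interior_eq_closure_of_nonempty_interior hne]
  exact subset_closure

/-- A compact subset of full measure of a body is the whole body. -/
theorem eq_of_subset_of_volume_le (C : FullConvexBody d) {s : Set (EuclideanSpace ℝ (Fin d))}
    (hs : IsCompact s) (hsub : s ⊆ C.toSet) (h : C.vol ≤ volume.real s) : s = C.toSet := by
  refine hsub.antisymm fun x hx => ?_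
  by_contra hxs
  have hcl : x ∈ closure (interior C.toSet) :=
    subset_closure_interior_of_convex C.convex_toSet C.2 hx
  have hne : (sᶜ ∩ interior C.toSet).Nonempty :=
    mem_closure_iff.1 hcl _ hs.isClosed.isOpen_compl hxs
  have hpos : 0 < volume (C.toSet \ s) :=
    ((hs.isClosed.isOpen_compl.inter isOpen_interior).measure_pos volume hne).trans_le
      (measure_mono fun y hy => ⟨interior_subset hy.2, hy.1⟩)
  have heq := measure_sdiff hsub hs.measurableSet.nullMeasurableSet hs.measure_lt_top.ne (μ := volume)
  have hle : volume C.toSet ≤ volume s :=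
    (ENNReal.toReal_le_toReal C.isCompact_toSet.measure_lt_top.ne hs.measure_lt_top.ne).1 h
  rw [tsub_eq_zero_of_le hle] at heq
  exact hpos.ne' heq

end Geometry

/-! ### The space of affine maps and the compact convex set of those sending `K` into a body -/

section AffineMaps

variable {d : ℕ}

/-- Affine self-maps of `ℝ^d`, as pairs of a linear part and a translation part. -/
abbrev AffSpace (d : ℕ) : Type :=
  (EuclideanSpace ℝ (Fin d) →L[ℝ] EuclideanSpace ℝ (Fin d)) × EuclideanSpace ℝ (Fin d)

namespace AffSpace

/-- Evaluation of an affine map at a point. -/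
def app (T : AffSpace d) (x : EuclideanSpace ℝ (Fin d)) : EuclideanSpace ℝ (Fin d) :=
  T.1 x + T.2

theorem continuous_app_prod :
    Continuous fun q : AffSpace d × EuclideanSpace ℝ (Fin d) => q.1.app q.2 := by
  unfold app
  fun_prop

theorem continuous_app_left (x : EuclideanSpace ℝ (Fin d)) :
    Continuous fun T : AffSpace d => T.app x :=
  continuous_app_prod.comp (by fun_prop : Continuous fun T : AffSpace d => (T, x))

theorem continuous_app (T : AffSpace d) : Continuous T.app :=
  continuous_app_prod.comp (by fun_prop : Continuous fun x => (T, x))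

theorem continuous_abs_det : Continuous fun T : AffSpace d => |T.1.det| :=
  (ContinuousLinearMap.continuous_det.comp continuous_fst).abs

theorem app_combo (T T' : AffSpace d) (a b : ℝ) (x : EuclideanSpace ℝ (Fin d)) :
    (a • T + b • T').app x = a • T.app x + b • T'.app x := by
  simp only [app, Prod.fst_add, Prod.smul_fst, Prod.snd_add, Prod.smul_snd,
    _root_.add_apply, _root_.smul_apply]
  module

theorem volume_image (T : AffSpace d) (s : Set (EuclideanSpace ℝ (Fin d))) :
    volume.real (T.app '' s) = |T.1.det| * volume.real s := by
  have : T.app '' s = (fun x => x + T.2) '' (T.1 '' s) := by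
    rw [Set.image_image]; rfl
  rw [this, Measure.real, Set.image_add_right, measure_preimage_add_right,
    Measure.addHaar_image_continuousLinearMap, ENNReal.toReal_mul,
    ENNReal.toReal_ofReal (abs_nonneg _), Measure.real]

/-- The affine map underlying an affine equivalence. -/
noncomputable def ofEquiv (S : EuclideanSpace ℝ (Fin d) ≃ᵃ[ℝ] EuclideanSpace ℝ (Fin d)) :
    AffSpace d :=
  (LinearMap.toContinuousLinearMap (S.linear :
    EuclideanSpace ℝ (Fin d) →ₗ[ℝ] EuclideanSpace ℝ (Fin d)), S 0)

/-- An affine map with nonzero determinant is an affine equivalence. -/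
noncomputable def toEquiv (T : AffSpace d) (h : T.1.det ≠ 0) :
    EuclideanSpace ℝ (Fin d) ≃ᵃ[ℝ] EuclideanSpace ℝ (Fin d) :=
  (LinearMap.equivOfDetNeZero (T.1 : EuclideanSpace ℝ (Fin d) →ₗ[ℝ] EuclideanSpace ℝ (Fin d))
    h).toAffineEquiv.trans (AffineEquiv.constVAdd ℝ _ T.2)

theorem toEquiv_apply (T : AffSpace d) (h : T.1.det ≠ 0) (x : EuclideanSpace ℝ (Fin d)) :
    T.toEquiv h x = T.app x :=
  add_comm T.2 (T.1 x)

/-- Post-composition with an affine equivalence. -/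
noncomputable def comp (S : EuclideanSpace ℝ (Fin d) ≃ᵃ[ℝ] EuclideanSpace ℝ (Fin d))
    (T : AffSpace d) : AffSpace d :=
  ((ofEquiv S).1.comp T.1, S T.2)

theorem comp_app (S : EuclideanSpace ℝ (Fin d) ≃ᵃ[ℝ] EuclideanSpace ℝ (Fin d)) (T : AffSpace d)
    (x : EuclideanSpace ℝ (Fin d)) : (comp S T).app x = S (T.app x) :=
  (S.map_vadd T.2 (T.1 x)).symm

theorem comp_comp_symm (S : EuclideanSpace ℝ (Fin d) ≃ᵃ[ℝ] EuclideanSpace ℝ (Fin d))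
    (T : AffSpace d) : comp S (comp S.symm T) = T := by
  refine Prod.ext (ContinuousLinearMap.ext fun x => ?_) (S.apply_symm_apply T.2)
  exact S.linear.apply_symm_apply (T.1 x)

theorem abs_det_comp (S : EuclideanSpace ℝ (Fin d) ≃ᵃ[ℝ] EuclideanSpace ℝ (Fin d))
    (T : AffSpace d) : |(comp S T).1.det| = |LinearMap.det (S.linear :
      EuclideanSpace ℝ (Fin d) →ₗ[ℝ] EuclideanSpace ℝ (Fin d))| * |T.1.det| := by
  rw [← abs_mul, ContinuousLinearMap.det, ContinuousLinearMap.det, ← LinearMap.det_comp]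
  rfl

end AffSpace

/-- The affine maps that send `K` into `s`. -/
def maps (K : FullConvexBody d) (s : Set (EuclideanSpace ℝ (Fin d))) : Set (AffSpace d) :=
  {T | ∀ x ∈ K.toSet, T.app x ∈ s}

theorem maps_mono (K : FullConvexBody d) {s t : Set (EuclideanSpace ℝ (Fin d))} (h : s ⊆ t) :
    K.maps s ⊆ K.maps t := fun _ hT x hx => h (hT x hx)

theorem mem_maps_iff_image (K : FullConvexBody d) {s : Set (EuclideanSpace ℝ (Fin d))}
    {T : AffSpace d} : T ∈ K.maps s ↔ T.app '' K.toSet ⊆ s := Set.image_subset_iff.symm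

theorem isClosed_maps (K : FullConvexBody d) {s : Set (EuclideanSpace ℝ (Fin d))}
    (hs : IsClosed s) : IsClosed (K.maps s) := by
  change IsClosed {T : AffSpace d | ∀ x ∈ K.toSet, T.app x ∈ s}
  simp only [Set.ofPred_forall]
  exact isClosed_iInter fun x => isClosed_iInter fun _ =>
    hs.preimage (AffSpace.continuous_app_left x)

theorem convex_maps (K : FullConvexBody d) {s : Set (EuclideanSpace ℝ (Fin d))}
    (hs : Convex ℝ s) : Convex ℝ (K.maps s) := by
  intro T hT T' hT' a b ha hb hab x hx
  rw [AffSpace.app_combo]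
  exact hs (hT x hx) (hT' x hx) ha hb hab

/-- `K` contains a ball, and bounded values on a ball bound the linear part; the value at the centre
then bounds the translation part. -/
theorem isBounded_maps (K : FullConvexBody d) {s : Set (EuclideanSpace ℝ (Fin d))}
    (hs : Bornology.IsBounded s) : Bornology.IsBounded (K.maps s) := by
  obtain ⟨c, r, hr, hc⟩ := K.exists_closedBall_subset
  obtain ⟨R, hR0, hR⟩ := hs.exists_pos_norm_le
  have hL : ∀ T ∈ K.maps s, ‖T.1‖ ≤ 2 * R / r := by
    intro T hT
    refine ContinuousLinearMap.opNorm_le_bound' _ (by positivity) fun x hx => ?_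
    have hx0 : 0 < ‖x‖ := (norm_nonneg x).lt_of_ne' hx
    have hz : c + (r / ‖x‖) • x ∈ closedBall c r := by
      rw [mem_closedBall, dist_eq_norm, add_sub_cancel_left, norm_smul,
        Real.norm_of_nonneg (by positivity), div_mul_cancel₀ _ hx]
    have h1 := hR _ (hT _ (hc hz))
    have h2 := hR _ (hT c (hc (mem_closedBall_self hr.le)))
    have h3 : (r / ‖x‖) • T.1 x = T.app (c + (r / ‖x‖) • x) - T.app c := by
      simp only [AffSpace.app, map_add, map_smul]
      abel
    have h4 : r / ‖x‖ * ‖T.1 x‖ ≤ R + R := by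
      rw [← Real.norm_of_nonneg (div_pos hr hx0).le, ← norm_smul, h3]
      exact (norm_sub_le _ _).trans (add_le_add h1 h2)
    rw [div_mul_eq_mul_div, div_le_iff₀ hx0] at h4
    rw [div_mul_eq_mul_div, le_div_iff₀ hr]
    linarith
  refine isBounded_iff_forall_norm_le.2 ⟨max (2 * R / r) (R + 2 * R / r * ‖c‖), fun T hT => ?_⟩
  refine max_le_max (hL T hT) ?_
  have h1 := hR _ (hT c (hc (mem_closedBall_self hr.le)))
  have h2 : T.2 = T.app c - T.1 c := by rw [AffSpace.app]; abel
  rw [h2]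
  exact (norm_sub_le _ _).trans (add_le_add h1 ((T.1.le_opNorm c).trans
    (mul_le_mul_of_nonneg_right (hL T hT) (norm_nonneg c))))

theorem isCompact_maps (K : FullConvexBody d) {s : Set (EuclideanSpace ℝ (Fin d))}
    (hs : IsCompact s) : IsCompact (K.maps s) :=
  isCompact_of_isClosed_isBounded (K.isClosed_maps hs.isClosed) (K.isBounded_maps hs.isBounded)

theorem const_mem_interior_maps (K : FullConvexBody d) {s : Set (EuclideanSpace ℝ (Fin d))}
    {c : EuclideanSpace ℝ (Fin d)} (hc : c ∈ interior s) :
    ((0, c) : AffSpace d) ∈ interior (K.maps s) := by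
  refine mem_interior_iff_mem_nhds.2 ?_
  refine K.isCompact_toSet.eventually_forall_of_forall_eventually fun x _ => ?_
  have : Tendsto (fun q : AffSpace d × EuclideanSpace ℝ (Fin d) => q.1.app q.2)
      (𝓝 ((0, c), x)) (𝓝 c) := by
    simpa [AffSpace.app] using (AffSpace.continuous_app_prod (d := d)).tendsto ((0, c), x)
  exact this (mem_interior_iff_mem_nhds.1 hc)

theorem interior_maps_nonempty (K C : FullConvexBody d) : (interior (K.maps C.toSet)).Nonempty :=
  let ⟨_, hc⟩ := C.2
  ⟨_, K.const_mem_interior_maps hc⟩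

/-- A map in the interior of `K.maps C₀` lies in `K.maps C` for all bodies `C` near `C₀`. -/
theorem eventually_mem_maps (K : FullConvexBody d) {C₀ : FullConvexBody d} {T : AffSpace d}
    (hT : T ∈ interior (K.maps C₀.toSet)) : ∀ᶠ C in 𝓝 C₀, T ∈ K.maps C.toSet := by
  obtain ⟨r, hr, h⟩ := nhds_basis_closedBall.mem_iff.1 (mem_interior_iff_mem_nhds.1 hT)
  filter_upwards [ball_mem_nhds C₀ hr] with C hC x hx
  refine mem_of_closedBall_subset (fun u hu => ?_) (mem_ball.1 hC)
  -- Changing only the translation part moves `T x` to any `u` within `r`, so the whole ball about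
  -- `T x` lies in `C₀`.
  have hmem : ((T.1, T.2 + (u - T.app x)) : AffSpace d) ∈ closedBall T r := by
    rw [mem_closedBall, Prod.dist_eq, dist_self, dist_eq_norm, add_sub_cancel_left, ← dist_eq_norm]
    exact max_le hr.le hu
  have hu' : AffSpace.app ((T.1, T.2 + (u - T.app x)) : AffSpace d) x = u := by
    simp only [AffSpace.app]
    abel
  exact hu' ▸ h hmem x hx

theorem isClosed_setOf_mem_toSet :
    IsClosed {q : FullConvexBody d × EuclideanSpace ℝ (Fin d) | q.2 ∈ q.1.toSet} := by
  refine isClosed_of_closure_subset fun ⟨C₀, x₀⟩ h => ?_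
  refine C₀.isClosed_toSet.closure_subset (Metric.mem_closure_iff.2 fun ε hε => ?_)
  obtain ⟨⟨C, x⟩, hx, hd⟩ := Metric.mem_closure_iff.1 h (ε / 2) (half_pos hε)
  rw [Prod.dist_eq, max_lt_iff] at hd
  obtain ⟨y, hy, hxy⟩ := exists_mem_dist_lt (by rw [dist_comm]; exact hd.1) hx
  refine ⟨y, hy, (dist_triangle x₀ x y).trans_lt ?_⟩
  linarith [hd.2]

theorem isClosed_setOf_mem_maps (K : FullConvexBody d) :
    IsClosed {q : FullConvexBody d × AffSpace d | q.2 ∈ K.maps q.1.toSet} := by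
  change IsClosed {q : FullConvexBody d × AffSpace d | ∀ x ∈ K.toSet, q.2.app x ∈ q.1.toSet}
  simp only [Set.ofPred_forall]
  exact isClosed_iInter fun x => isClosed_iInter fun _ => isClosed_setOf_mem_toSet.preimage
    (continuous_fst.prodMk ((AffSpace.continuous_app_left x).comp continuous_snd))

/-- Near `C₀`, all the sets `K.maps C` lie in one compact set. -/
theorem exists_isCompact_eventually_maps_subset (K C₀ : FullConvexBody d) :
    ∃ B : Set (AffSpace d), IsCompact B ∧ ∀ᶠ C in 𝓝 C₀, K.maps C.toSet ⊆ B := by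
  refine ⟨K.maps (cthickening 1 C₀.toSet), K.isCompact_maps C₀.isCompact_toSet.cthickening, ?_⟩
  filter_upwards [ball_mem_nhds C₀ one_pos] with C hC
  refine K.maps_mono fun x hx => ?_
  obtain ⟨y, hy, hxy⟩ := exists_mem_dist_lt (mem_ball.1 hC) hx
  exact mem_cthickening_of_dist_le x y 1 _ hy hxy.le

/-! ### The maximal determinant and the characterization of affine images -/

theorem comp_mem_maps_image (K C : FullConvexBody d)
    (S : EuclideanSpace ℝ (Fin d) ≃ᵃ[ℝ] EuclideanSpace ℝ (Fin d)) (T : AffSpace d) :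
    AffSpace.comp S T ∈ K.maps (C.image S).toSet ↔ T ∈ K.maps C.toSet := by
  refine forall₂_congr fun x _ => ?_
  rw [AffSpace.comp_app, toSet_image, S.injective.mem_set_image]

/-- The largest determinant (in absolute value) of an affine map sending `K` into `C`. -/
noncomputable def maxDet (K C : FullConvexBody d) : ℝ :=
  sSup ((fun T : AffSpace d => |T.1.det|) '' K.maps C.toSet)

theorem isCompact_abs_det_image (K C : FullConvexBody d) :
    IsCompact ((fun T : AffSpace d => |T.1.det|) '' K.maps C.toSet) :=
  (K.isCompact_maps C.isCompact_toSet).image AffSpace.continuous_abs_det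

theorem abs_det_le_maxDet {K C : FullConvexBody d} {T : AffSpace d} (hT : T ∈ K.maps C.toSet) :
    |T.1.det| ≤ K.maxDet C :=
  le_csSup (K.isCompact_abs_det_image C).bddAbove ⟨T, hT, rfl⟩

theorem exists_abs_det_eq_maxDet (K C : FullConvexBody d) :
    ∃ T ∈ K.maps C.toSet, |T.1.det| = K.maxDet C :=
  (K.isCompact_abs_det_image C).sSup_mem
    (((K.interior_maps_nonempty C).mono interior_subset).image _)

theorem maxDet_mono (K : FullConvexBody d) {C C' : FullConvexBody d} (h : C.toSet ⊆ C'.toSet) :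
    K.maxDet C ≤ K.maxDet C' := by
  obtain ⟨T, hT, hdet⟩ := K.exists_abs_det_eq_maxDet C
  rw [← hdet]
  exact abs_det_le_maxDet (K.maps_mono h hT)

theorem abs_det_linear_pos (S : EuclideanSpace ℝ (Fin d) ≃ᵃ[ℝ] EuclideanSpace ℝ (Fin d)) :
    0 < |LinearMap.det (S.linear : EuclideanSpace ℝ (Fin d) →ₗ[ℝ] EuclideanSpace ℝ (Fin d))| :=
  abs_pos.2 (LinearEquiv.isUnit_det' S.linear).ne_zero

theorem maxDet_image (K : FullConvexBody d)
    (S : EuclideanSpace ℝ (Fin d) ≃ᵃ[ℝ] EuclideanSpace ℝ (Fin d)) (C : FullConvexBody d) :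
    K.maxDet (C.image S) = |LinearMap.det (S.linear :
      EuclideanSpace ℝ (Fin d) →ₗ[ℝ] EuclideanSpace ℝ (Fin d))| * K.maxDet C := by
  apply le_antisymm
  · obtain ⟨T, hT, hdet⟩ := K.exists_abs_det_eq_maxDet (C.image S)
    rw [← hdet, ← AffSpace.comp_comp_symm S T, AffSpace.abs_det_comp]
    refine mul_le_mul_of_nonneg_left (abs_det_le_maxDet ?_) (abs_nonneg _)
    rwa [← comp_mem_maps_image K C S, AffSpace.comp_comp_symm]
  · obtain ⟨T, hT, hdet⟩ := K.exists_abs_det_eq_maxDet C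
    rw [← hdet, ← AffSpace.abs_det_comp]
    exact abs_det_le_maxDet ((comp_mem_maps_image K C S T).2 hT)

theorem continuous_maxDet (K : FullConvexBody d) : Continuous K.maxDet :=
  continuous_of_mono_of_image (fun _ _ h => K.maxDet_mono h) K.maxDet_image

theorem vol_image (S : EuclideanSpace ℝ (Fin d) ≃ᵃ[ℝ] EuclideanSpace ℝ (Fin d))
    (C : FullConvexBody d) : (C.image S).vol = |LinearMap.det (S.linear :
      EuclideanSpace ℝ (Fin d) →ₗ[ℝ] EuclideanSpace ℝ (Fin d))| * C.vol := by
  have : (S : EuclideanSpace ℝ (Fin d) → EuclideanSpace ℝ (Fin d)) = (AffSpace.ofEquiv S).app :=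
    funext fun x => by simpa [AffSpace.app, AffSpace.ofEquiv] using S.map_vadd 0 x
  rw [vol, toSet_image, this, AffSpace.volume_image]
  rfl

theorem continuous_vol : Continuous (vol (d := d)) :=
  continuous_of_mono_of_image (fun _ _ h => vol_mono h) vol_image

theorem abs_det_mul_vol_le {K C : FullConvexBody d} {T : AffSpace d} (hT : T ∈ K.maps C.toSet) :
    |T.1.det| * K.vol ≤ C.vol := by
  rw [vol, ← AffSpace.volume_image]
  exact measureReal_mono (K.mem_maps_iff_image.1 hT) C.isCompact_toSet.measure_lt_top.ne

/-- The image is a compact subset of `C`, so it is all of `C` as soon as it has full volume. -/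
theorem image_eq_iff {K C : FullConvexBody d} {T : AffSpace d} (hT : T ∈ K.maps C.toSet) :
    T.app '' K.toSet = C.toSet ↔ C.vol ≤ |T.1.det| * K.vol := by
  refine ⟨fun h => ?_, fun h => ?_⟩
  · rw [vol, ← h, AffSpace.volume_image, vol]
  · refine C.eq_of_subset_of_volume_le (K.isCompact_toSet.image T.continuous_app)
      (K.mem_maps_iff_image.1 hT) ?_
    rwa [AffSpace.volume_image]

theorem mem_maps_of_image_eq {K C : FullConvexBody d} {T : AffSpace d}
    (hT : T.app '' K.toSet = C.toSet) : T ∈ K.maps C.toSet :=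
  K.mem_maps_iff_image.2 hT.subset

theorem det_ne_zero_of_image_eq {K C : FullConvexBody d} {T : AffSpace d}
    (hT : T.app '' K.toSet = C.toSet) : T.1.det ≠ 0 := by
  intro h
  have := (image_eq_iff (mem_maps_of_image_eq hT)).1 hT
  rw [h, abs_zero, zero_mul] at this
  exact this.not_gt C.vol_pos

/-- A small multiple of the identity, translated to an interior point of `C`, sends `K` into `C`. -/
theorem maxDet_pos (K C : FullConvexBody d) : 0 < K.maxDet C := by
  obtain ⟨c, hc⟩ := C.2
  have hlim : Tendsto (fun t : ℝ => ((t • ContinuousLinearMap.id ℝ _, c) : AffSpace d))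
      (𝓝[>] 0) (𝓝 (0, c)) := by
    have hcont : Continuous (fun t : ℝ => ((t • ContinuousLinearMap.id ℝ _, c) : AffSpace d)) := by
      fun_prop
    have h0 : (((0 : ℝ) • ContinuousLinearMap.id ℝ _, c) : AffSpace d) = (0, c) :=
      Prod.ext (ContinuousLinearMap.ext fun x => zero_smul ℝ x) rfl
    exact (hcont.tendsto' 0 _ h0).mono_left nhdsWithin_le_nhds
  have hev := hlim.eventually (mem_interior_iff_mem_nhds.1 (K.const_mem_interior_maps hc))
  obtain ⟨t, ht, ht0⟩ := (hev.and self_mem_nhdsWithin).exists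
  refine lt_of_lt_of_le ?_ (abs_det_le_maxDet ht)
  have ht0' : (t : ℝ) ≠ 0 := ne_of_gt ht0
  rw [abs_pos, ContinuousLinearMap.det, ContinuousLinearMap.toLinearMap_smul, LinearMap.det_smul]
  simp [ht0']

/-- Affine maps with the same image of `K` agree at the fixed points of `K`. -/
theorem app_eq_of_image_eq {K C : FullConvexBody d} {x₀ : EuclideanSpace ℝ (Fin d)}
    (hfix : x₀ ∈ K.fixedPoints) {T T' : AffSpace d} (hT : T.app '' K.toSet = C.toSet)
    (hT' : T'.app '' K.toSet = C.toSet) : T.app x₀ = T'.app x₀ := by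
  set e := T.toEquiv (det_ne_zero_of_image_eq hT)
  set e' := T'.toEquiv (det_ne_zero_of_image_eq hT')
  have he : (e : EuclideanSpace ℝ (Fin d) → EuclideanSpace ℝ (Fin d)) = T.app :=
    funext (T.toEquiv_apply _)
  have he' : (e' : EuclideanSpace ℝ (Fin d) → EuclideanSpace ℝ (Fin d)) = T'.app :=
    funext (T'.toEquiv_apply _)
  rw [← he] at hT ⊢
  rw [← he'] at hT' ⊢
  -- Going out by `e` and back by `e'` is an affine symmetry of `K`, hence fixes `x₀`.
  have hsymm : (e.trans e'.symm) '' K.toSet = K.toSet := by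
    rw [AffineEquiv.coe_trans, Set.image_comp, hT, ← hT', ← Set.image_comp,
      ← AffineEquiv.coe_trans, AffineEquiv.self_trans_symm]
    simp
  have := hfix _ hsymm
  rwa [AffineEquiv.trans_apply, AffineEquiv.symm_apply_eq] at this

end AffineMaps

/-! ### Affine images, cutoff and weight -/

section WeightedAverage

variable {d : ℕ}

/-- A Haar measure on the space of affine maps. -/
@[irreducible] noncomputable def AffSpace.haar : Measure (AffSpace d) := Measure.addHaar

instance : (AffSpace.haar (d := d)).IsAddHaarMeasure := by
  rw [AffSpace.haar]
  infer_instance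

/-- `C` is the image of `K` under an affine map. -/
def IsAffineImage (K C : FullConvexBody d) : Prop := ∃ T : AffSpace d, T.app '' K.toSet = C.toSet

/-- The maximal determinant is attained, so full volume is reached by some map exactly when it is
reached by a maximizer. The criterion compares two continuous functions of `C`. -/
theorem isAffineImage_iff {K C : FullConvexBody d} :
    K.IsAffineImage C ↔ C.vol ≤ K.maxDet C * K.vol := by
  refine ⟨fun ⟨T, hT⟩ => ?_, fun h => ?_⟩
  · have hmem := mem_maps_of_image_eq hT
    exact ((image_eq_iff hmem).1 hT).trans
      (mul_le_mul_of_nonneg_right (abs_det_le_maxDet hmem) K.vol_pos.le)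
  · obtain ⟨T, hT, hdet⟩ := K.exists_abs_det_eq_maxDet C
    exact ⟨T, (image_eq_iff hT).2 (by rwa [hdet])⟩

theorem isOpen_setOf_not_isAffineImage (K : FullConvexBody d) :
    IsOpen {C | ¬ K.IsAffineImage C} := by
  simp only [isAffineImage_iff, not_le]
  exact isOpen_lt (K.continuous_maxDet.mul continuous_const) continuous_vol

/-- The determinant from which on a map `K → C` is counted in the weighted average. It is at most
`K.maxDet C`, with equality exactly for the affine images of `K`. -/
noncomputable def cutoff (K C : FullConvexBody d) : ℝ :=
  K.maxDet C * (K.maxDet C * K.vol / C.vol)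

theorem continuous_cutoff (K : FullConvexBody d) : Continuous K.cutoff :=
  K.continuous_maxDet.mul ((K.continuous_maxDet.mul continuous_const).div continuous_vol
    fun C => C.vol_pos.ne')

theorem cutoff_nonneg (K C : FullConvexBody d) : 0 ≤ K.cutoff C :=
  mul_nonneg (K.maxDet_pos C).le (div_nonneg
    (mul_nonneg (K.maxDet_pos C).le K.vol_pos.le) C.vol_pos.le)

/-- The ratio `maxDet * vol K / vol C` is affine invariant, so the cutoff scales like `maxDet`. -/
theorem cutoff_image (K : FullConvexBody d)
    (S : EuclideanSpace ℝ (Fin d) ≃ᵃ[ℝ] EuclideanSpace ℝ (Fin d)) (C : FullConvexBody d) :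
    K.cutoff (C.image S) = |LinearMap.det (S.linear :
      EuclideanSpace ℝ (Fin d) →ₗ[ℝ] EuclideanSpace ℝ (Fin d))| * K.cutoff C := by
  have := abs_det_linear_pos S
  have := C.vol_pos
  rw [cutoff, cutoff, maxDet_image, vol_image]
  field_simp

theorem maxDet_mul_vol_le (K C : FullConvexBody d) : K.maxDet C * K.vol ≤ C.vol := by
  obtain ⟨T, hT, hdet⟩ := K.exists_abs_det_eq_maxDet C
  rw [← hdet]
  exact abs_det_mul_vol_le hT

theorem cutoff_le_maxDet (K C : FullConvexBody d) : K.cutoff C ≤ K.maxDet C :=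
  mul_le_of_le_one_right (K.maxDet_pos C).le
    ((div_le_one C.vol_pos).2 (K.maxDet_mul_vol_le C))

theorem cutoff_lt_maxDet {K C : FullConvexBody d} (h : ¬ K.IsAffineImage C) :
    K.cutoff C < K.maxDet C := by
  rw [isAffineImage_iff, not_le] at h
  exact mul_lt_of_lt_one_right (K.maxDet_pos C) ((div_lt_one C.vol_pos).2 h)

theorem cutoff_eq_maxDet {K C : FullConvexBody d} (h : K.IsAffineImage C) :
    K.cutoff C = K.maxDet C := by
  rw [isAffineImage_iff] at h
  rw [cutoff, h.antisymm' (K.maxDet_mul_vol_le C), div_self C.vol_pos.ne', mul_one]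

theorem cutoff_le_abs_det {K C : FullConvexBody d} {T : AffSpace d}
    (hT : T.app '' K.toSet = C.toSet) : K.cutoff C ≤ |T.1.det| := by
  refine (K.cutoff_le_maxDet C).trans ?_
  have h := (image_eq_iff (mem_maps_of_image_eq hT)).1 hT
  exact le_of_mul_le_mul_right ((K.maxDet_mul_vol_le C).trans h) K.vol_pos

theorem image_eq_of_cutoff_le {K C : FullConvexBody d} (h : K.IsAffineImage C) {T : AffSpace d}
    (hT : T ∈ K.maps C.toSet) (hdet : K.cutoff C ≤ |T.1.det|) : T.app '' K.toSet = C.toSet := by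
  rw [cutoff_eq_maxDet h] at hdet
  exact (image_eq_iff hT).2 ((isAffineImage_iff.1 h).trans
    (mul_le_mul_of_nonneg_right hdet K.vol_pos.le))

/-- The weight of an affine map in the average defining the affine point. -/
noncomputable def weight (K C : FullConvexBody d) : AffSpace d → ℝ :=
  (K.maps C.toSet).indicator fun T => max 0 (|T.1.det| - K.cutoff C)

theorem weight_of_mem {K C : FullConvexBody d} {T : AffSpace d} (hT : T ∈ K.maps C.toSet) :
    K.weight C T = max 0 (|T.1.det| - K.cutoff C) := Set.indicator_of_mem hT _

theorem weight_of_notMem {K C : FullConvexBody d} {T : AffSpace d} (hT : T ∉ K.maps C.toSet) :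
    K.weight C T = 0 := Set.indicator_of_notMem hT _

theorem weight_nonneg (K C : FullConvexBody d) (T : AffSpace d) : 0 ≤ K.weight C T :=
  Set.indicator_nonneg (fun _ _ => le_max_left _ _) T

theorem weight_le (K C : FullConvexBody d) (T : AffSpace d) : K.weight C T ≤ |T.1.det| :=
  Set.indicator_apply_le' (fun _ => max_le (abs_nonneg _) (sub_le_self _ (K.cutoff_nonneg C)))
    fun _ => abs_nonneg _

theorem mem_of_weight_ne_zero {K C : FullConvexBody d} {T : AffSpace d} (h : K.weight C T ≠ 0) :
    T ∈ K.maps C.toSet ∧ K.cutoff C ≤ |T.1.det| := by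
  have hT : T ∈ K.maps C.toSet := by
    by_contra hT
    exact h (weight_of_notMem hT)
  refine ⟨hT, ?_⟩
  rw [weight_of_mem hT] at h
  by_contra hlt
  exact h (max_eq_left (by linarith))

theorem weight_image_comp (K : FullConvexBody d)
    (S : EuclideanSpace ℝ (Fin d) ≃ᵃ[ℝ] EuclideanSpace ℝ (Fin d)) (C : FullConvexBody d)
    (T : AffSpace d) : K.weight (C.image S) (AffSpace.comp S T) = |LinearMap.det (S.linear :
      EuclideanSpace ℝ (Fin d) →ₗ[ℝ] EuclideanSpace ℝ (Fin d))| * K.weight C T := by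
  by_cases hT : T ∈ K.maps C.toSet
  · rw [weight_of_mem hT, weight_of_mem ((comp_mem_maps_image K C S T).2 hT), cutoff_image,
      AffSpace.abs_det_comp, mul_max_of_nonneg _ _ (abs_nonneg _), mul_zero, mul_sub]
  · rw [weight_of_notMem hT, weight_of_notMem (mt (comp_mem_maps_image K C S T).1 hT), mul_zero]

theorem measurable_weight (K C : FullConvexBody d) : Measurable (K.weight C) := by
  refine Measurable.indicator ?_ (K.isClosed_maps C.isClosed_toSet).measurableSet
  have := AffSpace.continuous_abs_det (d := d)
  exact (continuous_const.max (this.sub continuous_const)).measurable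

/-- The cutoff is continuous in `C`, so the weight can jump only where membership in `K.maps C`
changes; off the frontier that membership is locally constant in `C`. -/
theorem continuousAt_weight (K : FullConvexBody d) {C₀ : FullConvexBody d} {T : AffSpace d}
    (hT : T ∉ frontier (K.maps C₀.toSet)) : ContinuousAt (fun C => K.weight C T) C₀ := by
  by_cases hmem : T ∈ K.maps C₀.toSet
  · have hint : T ∈ interior (K.maps C₀.toSet) := by
      by_contra h
      exact hT ⟨subset_closure hmem, h⟩
    have hc : Continuous fun C => max 0 (|T.1.det| - K.cutoff C) :=
      continuous_const.max (continuous_const.sub K.continuous_cutoff)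
    refine hc.continuousAt.congr ?_
    filter_upwards [K.eventually_mem_maps hint] with C hC
    exact (weight_of_mem hC).symm
  · refine (continuousAt_const (y := (0 : ℝ))).congr ?_
    have hopen := (K.isClosed_setOf_mem_maps.preimage
      (by fun_prop : Continuous fun C : FullConvexBody d => (C, T))).isOpen_compl
    filter_upwards [hopen.mem_nhds hmem] with C hC
    exact (weight_of_notMem hC).symm

/-! ### Continuity of weighted integrals in the body -/

section Integral

variable {F : Type*} [NormedAddCommGroup F] [NormedSpace ℝ F] {g : AffSpace d → F}

theorem norm_weight_smul_le (K C : FullConvexBody d) {B : Set (AffSpace d)}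
    (hB : K.maps C.toSet ⊆ B) (g : AffSpace d → F) (T : AffSpace d) :
    ‖K.weight C T • g T‖ ≤ B.indicator (fun T => |T.1.det| * ‖g T‖) T := by
  by_cases hT : T ∈ B
  · rw [Set.indicator_of_mem hT, norm_smul, Real.norm_of_nonneg (K.weight_nonneg C T)]
    exact mul_le_mul_of_nonneg_right (K.weight_le C T) (norm_nonneg _)
  · rw [Set.indicator_of_notMem hT, weight_of_notMem fun h => hT (hB h), zero_smul, norm_zero]

omit [NormedSpace ℝ F] in
theorem integrable_bound (hg : Continuous g) {B : Set (AffSpace d)} (hB : IsCompact B) :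
    Integrable (B.indicator fun T => |T.1.det| * ‖g T‖) AffSpace.haar := by
  rw [integrable_indicator_iff hB.measurableSet]
  exact (AffSpace.continuous_abs_det.mul hg.norm).continuousOn.integrableOn_compact hB

theorem aestronglyMeasurable_weight_smul [SecondCountableTopology F] (K C : FullConvexBody d)
    (hg : Continuous g) :
    AEStronglyMeasurable (fun T => K.weight C T • g T) AffSpace.haar :=
  (K.measurable_weight C).aestronglyMeasurable.smul hg.aestronglyMeasurable

theorem integrable_weight_smul [SecondCountableTopology F] (K C : FullConvexBody d)
    (hg : Continuous g) :
    Integrable (fun T => K.weight C T • g T) AffSpace.haar :=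
  (integrable_bound hg (K.isCompact_maps C.isCompact_toSet)).mono'
    (K.aestronglyMeasurable_weight_smul C hg)
    (Eventually.of_forall (K.norm_weight_smul_le C subset_rfl g))

theorem continuous_integral_weight_smul [SecondCountableTopology F] (K : FullConvexBody d)
    (hg : Continuous g) :
    Continuous fun C => ∫ T, K.weight C T • g T ∂AffSpace.haar := by
  rw [continuous_iff_continuousAt]
  intro C₀
  obtain ⟨B, hB, hsub⟩ := K.exists_isCompact_eventually_maps_subset C₀
  refine continuousAt_of_dominated
    (Eventually.of_forall fun C => K.aestronglyMeasurable_weight_smul C hg)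
    (hsub.mono fun C hC => Eventually.of_forall (K.norm_weight_smul_le C hC g))
    (integrable_bound hg hB) ?_
  -- The frontier of a convex set is Haar-null, so the integrand is continuous at `C₀` for almost
  -- every `T`.
  have hnull := (K.convex_maps C₀.convex_toSet).addHaar_frontier
    AffSpace.haar
  filter_upwards [measure_eq_zero_iff_ae_notMem.1 hnull] with T hT
  exact (K.continuousAt_weight hT).smul continuousAt_const

end Integral

/-- The total weight. -/
noncomputable def mass (K C : FullConvexBody d) : ℝ :=
  ∫ T, K.weight C T ∂AffSpace.haar

theorem integrable_weight (K C : FullConvexBody d) :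
    Integrable (K.weight C) AffSpace.haar := by
  simpa using K.integrable_weight_smul C (g := fun _ => (1 : ℝ)) continuous_const

theorem continuous_mass (K : FullConvexBody d) : Continuous K.mass := by
  unfold mass
  simpa only [smul_eq_mul, mul_one] using K.continuous_integral_weight_smul (g := fun _ => (1 : ℝ)) continuous_const

/-- A maximizer exceeds the cutoff strictly and is a limit of interior points of `K.maps C`, so the
weight is positive on a non-empty open set. -/
theorem mass_pos {K C : FullConvexBody d} (h : ¬ K.IsAffineImage C) : 0 < K.mass C := by
  rw [mass, integral_pos_iff_support_of_nonneg (K.weight_nonneg C) (K.integrable_weight C)]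
  obtain ⟨T, hT, hdet⟩ := K.exists_abs_det_eq_maxDet C
  have hopen : IsOpen {T : AffSpace d | K.cutoff C < |T.1.det|} :=
    isOpen_lt continuous_const AffSpace.continuous_abs_det
  have hcl : T ∈ closure (interior (K.maps C.toSet)) :=
    subset_closure_interior_of_convex (K.convex_maps C.convex_toSet)
      (K.interior_maps_nonempty C) hT
  have hne := mem_closure_iff.1 hcl _ hopen
    (show K.cutoff C < |T.1.det| by rw [hdet]; exact cutoff_lt_maxDet h)
  refine ((hopen.inter isOpen_interior).measure_pos _ hne).trans_le (measure_mono ?_)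
  rintro U ⟨hU, hU'⟩
  rw [Function.mem_support, weight_of_mem (interior_subset hU')]
  exact (lt_max_of_lt_right (sub_pos.2 hU)).ne'

/-- The weighted sum of the positions of `x₀`. -/
noncomputable def moment (K : FullConvexBody d) (x₀ : EuclideanSpace ℝ (Fin d))
    (C : FullConvexBody d) : EuclideanSpace ℝ (Fin d) :=
  ∫ T, K.weight C T • T.app x₀ ∂AffSpace.haar

theorem continuous_moment (K : FullConvexBody d) (x₀ : EuclideanSpace ℝ (Fin d)) :
    Continuous (K.moment x₀) :=
  K.continuous_integral_weight_smul (AffSpace.continuous_app_left x₀)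

/-- The normalized weight is a probability density, and the barycentre of a probability measure
carried by a closed convex set stays in that set. -/
theorem inv_mass_smul_moment_mem {K C : FullConvexBody d} (h : ¬ K.IsAffineImage C)
    {x₀ : EuclideanSpace ℝ (Fin d)} {s : Set (EuclideanSpace ℝ (Fin d))} (hs : Convex ℝ s)
    (hsc : IsClosed s)
    (hmem : ∀ T ∈ K.maps C.toSet, K.cutoff C ≤ |T.1.det| → T.app x₀ ∈ s) :
    (K.mass C)⁻¹ • K.moment x₀ C ∈ s := by
  set ν : Measure (AffSpace d) :=
    AffSpace.haar.withDensity fun T => ENNReal.ofReal ((K.mass C)⁻¹ * K.weight C T)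
  have hmeas : Measurable fun T => ENNReal.ofReal ((K.mass C)⁻¹ * K.weight C T) :=
    ((K.measurable_weight C).const_mul _).ennreal_ofReal
  have hnn : ∀ T, 0 ≤ (K.mass C)⁻¹ * K.weight C T := fun T =>
    mul_nonneg (inv_nonneg.2 (mass_pos h).le) (K.weight_nonneg C T)
  have hfin : ∀ᵐ T ∂AffSpace.haar,
      ENNReal.ofReal ((K.mass C)⁻¹ * K.weight C T) < ⊤ :=
    Eventually.of_forall fun _ => ENNReal.ofReal_lt_top
  have hprob : IsProbabilityMeasure ν := by
    constructor
    rw [withDensity_apply _ MeasurableSet.univ, Measure.restrict_univ,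
      ← ofReal_integral_eq_lintegral_ofReal ((K.integrable_weight C).const_mul _)
        (Eventually.of_forall hnn), integral_const_mul, ← mass, inv_mul_cancel₀ (mass_pos h).ne',
      ENNReal.ofReal_one]
  have hint : Integrable (fun T : AffSpace d => T.app x₀) ν := by
    rw [integrable_withDensity_iff_integrable_smul' hmeas hfin]
    simp only [ENNReal.toReal_ofReal (hnn _), mul_smul]
    exact (K.integrable_weight_smul C (AffSpace.continuous_app_left x₀)).smul (K.mass C)⁻¹
  have hae : ∀ᵐ T ∂ν, T.app x₀ ∈ s := by
    rw [ae_withDensity_iff hmeas]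
    refine Eventually.of_forall fun T hT => ?_
    have hw : K.weight C T ≠ 0 := fun h0 => hT (by simp [h0])
    exact hmem T (mem_of_weight_ne_zero hw).1 (mem_of_weight_ne_zero hw).2
  have hmain := hs.integral_mem hsc hae hint
  rw [integral_withDensity_eq_integral_toReal_smul hmeas hfin] at hmain
  simp only [ENNReal.toReal_ofReal (hnn _), mul_smul] at hmain
  rwa [integral_smul] at hmain

/-- Composition with a linear map, on pairs of a linear part and a translation part. -/
noncomputable def AffSpace.linComp (A : EuclideanSpace ℝ (Fin d) →L[ℝ] EuclideanSpace ℝ (Fin d)) :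
    AffSpace d →ₗ[ℝ] AffSpace d where
  toFun T := (A.comp T.1, A T.2)
  map_add' T T' := Prod.ext (A.comp_add T.1 T'.1) (map_add A T.2 T'.2)
  map_smul' c T := Prod.ext (A.comp_smul c T.1) (map_smul A c T.2)

theorem AffSpace.linComp_injective
    (S : EuclideanSpace ℝ (Fin d) ≃ᵃ[ℝ] EuclideanSpace ℝ (Fin d)) :
    Function.Injective (AffSpace.linComp (AffSpace.ofEquiv S).1) := by
  intro T T' h
  refine Prod.ext (ContinuousLinearMap.ext fun x => S.linear.injective ?_)
    (S.linear.injective (congrArg Prod.snd h))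
  exact congrArg (fun U : AffSpace d => U.1 x) h

theorem AffSpace.comp_eq (S : EuclideanSpace ℝ (Fin d) ≃ᵃ[ℝ] EuclideanSpace ℝ (Fin d))
    (T : AffSpace d) :
    AffSpace.comp S T = AffSpace.linComp (AffSpace.ofEquiv S).1 T + (0, S 0) := by
  refine Prod.ext (add_zero _).symm ?_
  simpa [AffSpace.comp, AffSpace.linComp, AffSpace.ofEquiv] using S.map_vadd 0 T.2

/-- Post-composition with an affine equivalence multiplies the Haar measure by a constant. -/
theorem exists_integral_comp (S : EuclideanSpace ℝ (Fin d) ≃ᵃ[ℝ] EuclideanSpace ℝ (Fin d)) :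
    ∃ c : ℝ, ∀ (F : Type) [NormedAddCommGroup F] [NormedSpace ℝ F] (f : AffSpace d → F),
      ∫ T, f (AffSpace.comp S T) ∂AffSpace.haar
        = c • ∫ T, f T ∂AffSpace.haar := by
  set Φ := AffSpace.linComp (AffSpace.ofEquiv S).1 with hΦ
  have hinj : Function.Injective Φ := AffSpace.linComp_injective S
  have hdet : LinearMap.det Φ ≠ 0 := by
    exact (LinearEquiv.ofInjectiveEndo Φ hinj).isUnit_det'.ne_zero
  have hemb : MeasurableEmbedding Φ :=
    (LinearMap.isClosedEmbedding_of_injective (LinearMap.ker_eq_bot.2 hinj)).measurableEmbedding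
  -- Post-composition is `Φ` followed by a translation. The constant is independent of `f` and `F`,
  -- so mass and moment share it.
  refine ⟨|(LinearMap.det Φ)⁻¹|, fun F _ _ f => ?_⟩
  simp only [AffSpace.comp_eq, ← hΦ]
  rw [← hemb.integral_map (g := fun T => f (T + (0, S 0))),
    Measure.map_linearMap_addHaar_eq_smul_addHaar _ hdet, integral_smul_measure,
    ENNReal.toReal_ofReal (abs_nonneg _), integral_add_right_eq_self]

theorem isAffineImage_image {K C : FullConvexBody d}
    (S : EuclideanSpace ℝ (Fin d) ≃ᵃ[ℝ] EuclideanSpace ℝ (Fin d)) :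
    K.IsAffineImage (C.image S) ↔ K.IsAffineImage C := by
  rw [isAffineImage_iff, isAffineImage_iff, vol_image, maxDet_image, mul_assoc,
    mul_le_mul_iff_right₀ (abs_det_linear_pos S)]

theorem inv_mass_smul_moment_image {K C : FullConvexBody d} (h : ¬ K.IsAffineImage C)
    (x₀ : EuclideanSpace ℝ (Fin d))
    (S : EuclideanSpace ℝ (Fin d) ≃ᵃ[ℝ] EuclideanSpace ℝ (Fin d)) :
    (K.mass (C.image S))⁻¹ • K.moment x₀ (C.image S) = S ((K.mass C)⁻¹ • K.moment x₀ C) := by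
  obtain ⟨c, hc⟩ := exists_integral_comp S
  set δ := |LinearMap.det (S.linear : EuclideanSpace ℝ (Fin d) →ₗ[ℝ] EuclideanSpace ℝ (Fin d))|
  set A := (AffSpace.ofEquiv S).1
  have hS : ∀ y, S y = A y + S 0 := fun y => by
    simpa [A, AffSpace.ofEquiv] using S.map_vadd 0 y
  have hδ : 0 < δ := abs_det_linear_pos S
  have hm := mass_pos h
  have hmass : δ * K.mass C = c * K.mass (C.image S) := by
    rw [mass, mass, ← smul_eq_mul c, ← hc, ← integral_const_mul]
    exact integral_congr_ae (Eventually.of_forall fun T => (K.weight_image_comp S C T).symm)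
  -- The value of `c` is irrelevant as it cancels; that it is non-zero follows from positivity of
  -- the mass.
  have hc0 : c ≠ 0 := by
    rintro rfl
    rw [zero_mul] at hmass
    exact (mul_pos hδ hm).ne' hmass
  have hint := K.integrable_weight_smul C (AffSpace.continuous_app_left x₀)
  have hmoment : c • K.moment x₀ (C.image S)
      = δ • (A (K.moment x₀ C) + K.mass C • S 0) := by
    rw [moment, ← hc, moment, ← ContinuousLinearMap.integral_comp_comm A hint, mass,
      ← integral_smul_const, ← integral_add (A.integrable_comp hint)
        ((K.integrable_weight C).smul_const _), ← integral_smul]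
    refine integral_congr_ae (Eventually.of_forall fun T => ?_)
    simp only [weight_image_comp, AffSpace.comp_app, hS (T.app x₀), map_smul, mul_smul, smul_add]
    rfl
  have hm' : K.mass (C.image S) = c⁻¹ * (δ * K.mass C) := by
    rw [hmass, inv_mul_cancel_left₀ hc0]
  have hmom' : K.moment x₀ (C.image S) = c⁻¹ • δ • (A (K.moment x₀ C) + K.mass C • S 0) := by
    rw [← hmoment, inv_smul_smul₀ hc0]
  rw [hm', hmom', hS ((K.mass C)⁻¹ • K.moment x₀ C), map_smul, smul_smul, smul_smul, smul_add, smul_smul]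
  congr 1
  · congr 1
    field_simp
  · rw [show (c⁻¹ * (δ * K.mass C))⁻¹ * c⁻¹ * δ * K.mass C = 1 by field_simp, one_smul]

/-! ### The affine point: membership, continuity, equivariance -/

open Classical in
/-- The affine point through `x₀`: the position of `x₀` in affine images of `K`,
and a weighted average of its positions under affine maps `K → C` of almost maximal determinant for
all other bodies `C`. -/
noncomputable def averagePoint (K : FullConvexBody d) (x₀ : EuclideanSpace ℝ (Fin d))
    (C : FullConvexBody d) : EuclideanSpace ℝ (Fin d) :=
  if h : K.IsAffineImage C then h.choose.app x₀ else (K.mass C)⁻¹ • K.moment x₀ C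

theorem averagePoint_of_not {K C : FullConvexBody d} (h : ¬ K.IsAffineImage C)
    (x₀ : EuclideanSpace ℝ (Fin d)) : K.averagePoint x₀ C = (K.mass C)⁻¹ • K.moment x₀ C :=
  dif_neg h

theorem averagePoint_eq {K C : FullConvexBody d} {x₀ : EuclideanSpace ℝ (Fin d)}
    (hfix : x₀ ∈ K.fixedPoints) {T : AffSpace d} (hT : T.app '' K.toSet = C.toSet) :
    K.averagePoint x₀ C = T.app x₀ := by
  have h : K.IsAffineImage C := ⟨T, hT⟩
  rw [averagePoint, dif_pos h]
  exact app_eq_of_image_eq hfix h.choose_spec hT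

/-- Treats both branches of the definition at once. With `s` the body it locates the point; with `s`
a small ball it gives continuity at affine images. -/
theorem averagePoint_mem_of_forall {K C : FullConvexBody d} {x₀ : EuclideanSpace ℝ (Fin d)}
    {s : Set (EuclideanSpace ℝ (Fin d))} (hs : Convex ℝ s) (hsc : IsClosed s)
    (hmem : ∀ T ∈ K.maps C.toSet, K.cutoff C ≤ |T.1.det| → T.app x₀ ∈ s) :
    K.averagePoint x₀ C ∈ s := by
  by_cases h : K.IsAffineImage C
  · rw [averagePoint, dif_pos h]
    exact hmem _ (mem_maps_of_image_eq h.choose_spec) (cutoff_le_abs_det h.choose_spec)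
  · rw [averagePoint_of_not h]
    exact inv_mass_smul_moment_mem h hs hsc hmem

theorem averagePoint_mem (K C : FullConvexBody d) {x₀ : EuclideanSpace ℝ (Fin d)}
    (hx₀ : x₀ ∈ K.toSet) : K.averagePoint x₀ C ∈ C.toSet :=
  averagePoint_mem_of_forall C.convex_toSet C.isClosed_toSet fun _ hT _ => hT x₀ hx₀

theorem continuous_averagePoint {K : FullConvexBody d} {x₀ : EuclideanSpace ℝ (Fin d)}
    (hfix : x₀ ∈ K.fixedPoints) : Continuous (K.averagePoint x₀) := by
  rw [continuous_iff_continuousAt]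
  intro C₀
  by_cases h : K.IsAffineImage C₀
  · refine Metric.nhds_basis_closedBall.tendsto_right_iff.2 fun ε hε => ?_
    obtain ⟨B, hB, hsub⟩ := K.exists_isCompact_eventually_maps_subset C₀
    -- Compactness of `B` reduces this to neighbourhoods of each `(C₀, T)`. Either `T` is onto `C₀`
    -- and has the right value at `x₀`, or it violates one of the two closed conditions, as do all
    -- nearby pairs.
    have key : ∀ᶠ C in 𝓝 C₀, ∀ T ∈ B, T ∈ K.maps C.toSet → K.cutoff C ≤ |T.1.det| →
        T.app x₀ ∈ closedBall (K.averagePoint x₀ C₀) ε := by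
      refine hB.eventually_forall_of_forall_eventually fun T _ => ?_
      by_cases hT : T ∈ K.maps C₀.toSet
      · by_cases hdet : K.cutoff C₀ ≤ |T.1.det|
        · have happ := averagePoint_eq hfix (image_eq_of_cutoff_le h hT hdet)
          have hlim : Tendsto (fun q : FullConvexBody d × AffSpace d => q.2.app x₀)
              (𝓝 (C₀, T)) (𝓝 (T.app x₀)) :=
            ((AffSpace.continuous_app_left x₀).comp continuous_snd).tendsto (C₀, T)
          rw [happ]
          filter_upwards [hlim (closedBall_mem_nhds _ hε)] with q hq _ _ using hq
        · have hopen : IsOpen {q : FullConvexBody d × AffSpace d | |q.2.1.det| < K.cutoff q.1} :=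
            isOpen_lt (AffSpace.continuous_abs_det.comp continuous_snd)
              (K.continuous_cutoff.comp continuous_fst)
          filter_upwards [hopen.mem_nhds (not_le.1 hdet)] with q hq _ hle
          exact absurd hle (not_le.2 hq)
      · filter_upwards [K.isClosed_setOf_mem_maps.isOpen_compl.mem_nhds hT] with q hq hmem
        exact absurd hmem hq
    filter_upwards [key, hsub] with C hC hCB
    exact averagePoint_mem_of_forall (convex_closedBall _ _) isClosed_closedBall
      fun T hT => hC T (hCB hT) hT
  · have hc : ContinuousAt (fun C => (K.mass C)⁻¹ • K.moment x₀ C) C₀ :=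
      (K.continuous_mass.continuousAt.inv₀ (mass_pos h).ne').smul
        (K.continuous_moment x₀).continuousAt
    refine hc.congr ?_
    filter_upwards [K.isOpen_setOf_not_isAffineImage.mem_nhds h] with C hC
    exact (averagePoint_of_not hC x₀).symm

theorem averagePoint_image {K : FullConvexBody d} {x₀ : EuclideanSpace ℝ (Fin d)}
    (hfix : x₀ ∈ K.fixedPoints) (S : EuclideanSpace ℝ (Fin d) ≃ᵃ[ℝ] EuclideanSpace ℝ (Fin d))
    (C : FullConvexBody d) : K.averagePoint x₀ (C.image S) = S (K.averagePoint x₀ C) := by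
  by_cases h : K.IsAffineImage C
  · obtain ⟨T, hT⟩ := h
    have hST : (AffSpace.comp S T).app '' K.toSet = (C.image S).toSet := by
      rw [toSet_image, ← hT, Set.image_image]
      simp only [AffSpace.comp_app]
    rw [averagePoint_eq hfix hT, averagePoint_eq hfix hST, AffSpace.comp_app]
  · rw [averagePoint_of_not h, averagePoint_of_not (mt (isAffineImage_image S).1 h),
      inv_mass_smul_moment_image h]

theorem averagePoint_self {K : FullConvexBody d} {x₀ : EuclideanSpace ℝ (Fin d)}
    (hfix : x₀ ∈ K.fixedPoints) : K.averagePoint x₀ K = x₀ := by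
  have happ : ∀ x, AffSpace.app ((ContinuousLinearMap.id ℝ _, 0) : AffSpace d) x = x :=
    fun x => add_zero x
  rw [averagePoint_eq (T := (ContinuousLinearMap.id ℝ _, 0)) hfix (by simp [happ]), happ]

end WeightedAverage

end FullConvexBody

theorem proposition6p2 (d : ℕ) (hd : 2 ≤ d) (K : FullConvexBody d)
    (x₀ : EuclideanSpace ℝ (Fin d)) (hfix : x₀ ∈ K.fixedPoints)
    (hbd : x₀ ∈ frontier K.toSet) :
    ∃ p : FullConvexBody d → EuclideanSpace ℝ (Fin d),
      IsAffinePoint p ∧ p K = x₀ ∧ ∀ C : FullConvexBody d, p C ∈ C.toSet := by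
  have hx₀ : x₀ ∈ K.toSet := K.isClosed_toSet.frontier_subset hbd
  exact ⟨K.averagePoint x₀, ⟨FullConvexBody.continuous_averagePoint hfix,
    FullConvexBody.averagePoint_image hfix⟩, FullConvexBody.averagePoint_self hfix,
    fun C => K.averagePoint_mem C hx₀⟩
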